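/- Let $k$ be a field of characteristic zero. A unitary $R$-matrix on a finite-dimensional $k$-vector space $V$ is an automorphism $R$ of $V\otimes V$ with $R^2=1$ and $R_1R_2R_1=R_2R_1R_2$ on $V^{\otimes 3}$, where $R_1=R\otimes I_V$ and $R_2=I_V\otimes R$. Let $\mathcal T_k$ be the free $k$-linear abelian tensor category. Its objects are the families $M=(M_n)_{n\ge 0}$ of finite-dimensional representations $M_n$ of the symmetric groups $S_n$ over $k$, with $M_n=0$ for all but finitely many $n$; morphisms are taken degreewise. Let $X$ be its tensor generator, the trivial representation of $S_1$ in degree $1$, so that $X^{\otimes n}$ is $k[S_n]$ in degree $n$, and let $\Lambda^nX\in\mathcal T_k$ be the sign representation of $S_n$ in degree $n$. A unitary $R$-matrix $R$ on $V$ makes $V^{\otimes n}$ a representation $\sigma\mapsto R_\sigma$ of $S_n$, in which the transposition of $i$ and $i+1$ acts by $R$ on the tensor factors $i$ and $i+1$ and by the identity on the others. Let $$F_R:\mathcal T_k\to k\text{-}\mathrm{mod},\qquad F_R(M)=\bigoplus_{n\ge 0}V^{\otimes n}\otimes_{k[S_n]}M_n,$$ be the functor to finite-dimensional vector spaces underlying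 the $k$-linear monoidal functor with $X\mapsto V$ that sends the generator $\tau$ of $S_2\subset\mathrm{Aut}(X^{\otimes 2})$ to $R$. The Hilbert series of $R$ is $$H_R(t)=\sum_{n\ge 0}\dim_k F_R(\Lambda^nX)\,t^n .$$ Let $R$ and $S$ be unitary $R$-matrices on finite-dimensional $k$-vector spaces $V$ and $W$. Then the functors $F_R$ and $F_S$ are isomorphic as functors (the isomorphism is not required to be compatible with the monoidal structures) if and only if $H_R(t)=H_S(t)$. -/

import Mathlib

open CategoryTheory TensorProduct DirectSum

universe u

noncomputable section

namespace FreeTensor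

/-! ### The Coxeter presentation of the symmetric group -/

section Coxeter

variable {G : Type*} [Group G]

/-- The Coxeter relations of type `A` for the first `n` terms of the sequence `t`. -/
structure IsCoxeterFamily (t : ℕ → G) (n : ℕ) : Prop where
  sq : ∀ i, i < n → t i * t i = 1
  braid : ∀ i, i + 1 < n → t i * t (i + 1) * t i = t (i + 1) * t i * t (i + 1)
  comm : ∀ i j, i + 1 < j → j < n → t i * t j = t j * t i

/-- The product `t 0 * t 1 * ⋯ * t (j - 1)`. -/
def cosetRep (t : ℕ → G) : ℕ → G
  | 0 => 1
  | j + 1 => cosetRep t j * t j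

theorem cosetRep_comm {t : ℕ → G} {n : ℕ} (ht : IsCoxeterFamily t n) (i : ℕ) (hi : i < n) :
    ∀ j, j < i → cosetRep t j * t i = t i * cosetRep t j
  | 0, _ => by simp [cosetRep]
  | j + 1, hj => by
      rw [cosetRep, mul_assoc, ht.comm j i hj hi, ← mul_assoc,
        cosetRep_comm ht i hi j (by omega), mul_assoc]

theorem cosetRep_shift {t : ℕ → G} {n : ℕ} (ht : IsCoxeterFamily t n) (i : ℕ) :
    ∀ j, i + 1 < j → j ≤ n → cosetRep t j * t i = t (i + 1) * cosetRep t j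
  | 0, h, _ => by omega
  | j + 1, h, hn => by
      rcases Nat.lt_or_ge (i + 1) j with h1 | h1
      · rw [cosetRep, mul_assoc, ← ht.comm i j h1 (by omega), ← mul_assoc,
          cosetRep_shift ht i j h1 (by omega), mul_assoc]
      · obtain rfl : j = i + 1 := by omega
        have hb := ht.braid i (by omega)
        have hc := cosetRep_comm ht (i + 1) (by omega) i (by omega)
        calc cosetRep t i * t i * t (i + 1) * t i
            = cosetRep t i * (t i * t (i + 1) * t i) := by simp only [mul_assoc]
          _ = cosetRep t i * t (i + 1) * (t i * t (i + 1)) := by rw [hb]; simp only [mul_assoc]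
          _ = t (i + 1) * (cosetRep t i * t i * t (i + 1)) := by rw [hc]; simp only [mul_assoc]

theorem IsCoxeterFamily.tail {t : ℕ → G} {n : ℕ} (ht : IsCoxeterFamily t (n + 1)) :
    IsCoxeterFamily (fun i => t (i + 1)) n where
  sq i hi := ht.sq (i + 1) (by omega)
  braid i hi := ht.braid (i + 1) (by omega)
  comm i j hi hj := ht.comm (i + 1) (j + 1) (by omega) (by omega)

/-- A group generated by `n` elements that satisfy the Coxeter relations has at most `(n + 1)!`
elements. -/
theorem IsCoxeterFamily.closure_bound : ∀ (n : ℕ) (t : ℕ → G), IsCoxeterFamily t n →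
    ∃ S : Finset G, (Subgroup.closure (t '' Set.Iio n) : Set G) ⊆ S ∧
      S.card ≤ (n + 1).factorial
  | 0, t, _ => ⟨{1}, by simp, by simp⟩
  | n + 1, t, ht => by
      classical
      obtain ⟨S, hS, hc⟩ := IsCoxeterFamily.closure_bound n _ ht.tail
      set K := Subgroup.closure ((fun i => t (i + 1)) '' Set.Iio n) with hK
      have hmem : ∀ i, i < n → t (i + 1) ∈ K := fun i hi =>
        Subgroup.subset_closure ⟨i, hi, rfl⟩
      refine ⟨Finset.image₂ (· * ·) S ((Finset.range (n + 2)).image (cosetRep t)), ?_, ?_⟩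
      · have key : ∀ x ∈ Subgroup.closure (t '' Set.Iio (n + 1)),
            ∃ a ∈ K, ∃ j, j ≤ n + 1 ∧ x = a * cosetRep t j := by
          have step : ∀ x y, y ∈ t '' Set.Iio (n + 1) →
              (∃ a ∈ K, ∃ j, j ≤ n + 1 ∧ x = a * cosetRep t j) →
              ∃ a ∈ K, ∃ j, j ≤ n + 1 ∧ x * y = a * cosetRep t j := by
            rintro x y ⟨i, hi, rfl⟩ ⟨a, ha, j, hj, rfl⟩
            have hi' : i < n + 1 := hi
            rcases Nat.lt_trichotomy i j with h | h | h
            · rcases Nat.lt_or_ge (i + 1) j with h1 | h1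
              · refine ⟨a * t (i + 1), K.mul_mem ha (hmem i (by omega)), j, hj, ?_⟩
                rw [mul_assoc, cosetRep_shift ht i j h1 hj, mul_assoc]
              · obtain rfl : j = i + 1 := by omega
                refine ⟨a, ha, i, by omega, ?_⟩
                rw [cosetRep, mul_assoc, mul_assoc, ht.sq i hi', mul_one]
            · subst h
              exact ⟨a, ha, i + 1, by omega, by rw [cosetRep, mul_assoc]⟩
            · obtain ⟨m, rfl⟩ : ∃ m, i = m + 1 := ⟨i - 1, by omega⟩
              refine ⟨a * t (m + 1), K.mul_mem ha (hmem m (by omega)), j, hj, ?_⟩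
              rw [mul_assoc, cosetRep_comm ht (m + 1) hi' j h, mul_assoc]
          intro x hx
          induction hx using Subgroup.closure_induction_right with
          | one => exact ⟨1, K.one_mem, 0, by omega, by simp [cosetRep]⟩
          | mul_right x _ y hy ih => exact step x y hy ih
          | mul_inv_cancel x _ y hy ih =>
              have : y⁻¹ = y := by
                obtain ⟨i, hi, rfl⟩ := hy
                exact inv_eq_of_mul_eq_one_left (ht.sq i hi)
              rw [this]
              exact step x y hy ih
        intro x hx
        obtain ⟨a, ha, j, hj, rfl⟩ := key x hx
        exact Finset.mem_coe.2 (Finset.mem_image₂_of_mem (hS ha)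
          (Finset.mem_image_of_mem _ (Finset.mem_range.2 (by omega))))
      · calc _ ≤ S.card * ((Finset.range (n + 2)).image (cosetRep t)).card :=
              Finset.card_image₂_le _ _ _
          _ ≤ (n + 1).factorial * (n + 2) :=
              Nat.mul_le_mul hc (Finset.card_image_le.trans (by simp))
          _ = (n + 1 + 1).factorial := by rw [Nat.factorial_succ (n + 1), mul_comm]

/-- The adjacent transposition of the places `i` and `i + 1` (counted from `0`). -/
def adjSwap {n : ℕ} (i : ℕ) (h : i + 1 < n) : Equiv.Perm (Fin n) :=
  Equiv.swap ⟨i, Nat.lt_of_succ_lt h⟩ ⟨i + 1, h⟩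

/-- The adjacent transpositions satisfy the Coxeter relations. -/
theorem adjSwap_isCoxeterFamily (m : ℕ) :
    IsCoxeterFamily
      (fun i => if h : i + 1 < m + 1 then adjSwap i h else (1 : Equiv.Perm (Fin (m + 1)))) m where
  sq i hi := by simp [hi, adjSwap]
  braid i hi := by
    have hi0 : i < m := by omega
    have h1 : (⟨i, by omega⟩ : Fin (m + 1)) ≠ ⟨i + 1, by omega⟩ := by simp
    have h2 : (⟨i, by omega⟩ : Fin (m + 1)) ≠ ⟨i + 1 + 1, by omega⟩ := by
      simp only [ne_eq, Fin.mk.injEq]; omega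
    have h3 : (⟨i + 1, by omega⟩ : Fin (m + 1)) ≠ ⟨i + 1 + 1, by omega⟩ := by simp
    simp only [Nat.add_lt_add_iff_right, hi, hi0, dite_true, adjSwap]
    rw [Equiv.swap_mul_swap_mul_swap h1 h2]
    generalize (⟨i, _⟩ : Fin (m + 1)) = a at *
    generalize (⟨i + 1, _⟩ : Fin (m + 1)) = b at *
    generalize (⟨i + 1 + 1, _⟩ : Fin (m + 1)) = c at *
    rw [Equiv.swap_comm a b, Equiv.swap_comm b c,
      Equiv.swap_mul_swap_mul_swap h3.symm h2.symm, Equiv.swap_comm]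
  comm i j hij hj := by
    have hi0 : i < m := by omega
    simp only [Nat.add_lt_add_iff_right, hj, hi0, dite_true, adjSwap]
    refine (Equiv.Perm.disjoint_iff_disjoint_support.2 ?_).commute
    rw [Equiv.Perm.support_swap (by simp), Equiv.Perm.support_swap (by simp)]
    simp only [Finset.disjoint_insert_left, Finset.disjoint_singleton_left, Finset.mem_insert,
      Finset.mem_singleton, Fin.mk.injEq]
    omega

/-- Elements satisfying the Coxeter relations define a homomorphism from the symmetric group. -/
theorem exists_permHom (n : ℕ) (t : ℕ → G) (ht : IsCoxeterFamily t (n - 1)) :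
    ∃ φ : Equiv.Perm (Fin n) →* G, ∀ i (h : i + 1 < n), φ (adjSwap i h) = t i := by
  obtain _ | m := n
  · exact ⟨1, fun i h => by omega⟩
  classical
  rw [Nat.add_sub_cancel] at ht
  set s : ℕ → Equiv.Perm (Fin (m + 1)) :=
    fun i => if h : i + 1 < m + 1 then adjSwap i h else 1 with hs
  have hsf : IsCoxeterFamily s m := adjSwap_isCoxeterFamily m
  have hu : IsCoxeterFamily (fun i => (s i, t i)) m :=
    { sq := fun i hi => Prod.ext (hsf.sq i hi) (ht.sq i hi)
      braid := fun i hi => Prod.ext (hsf.braid i hi) (ht.braid i hi)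
      comm := fun i j hi hj => Prod.ext (hsf.comm i j hi hj) (ht.comm i j hi hj) }
  set K := Subgroup.closure ((fun i => (s i, t i)) '' Set.Iio m) with hK
  have hmem : ∀ i (h : i + 1 < m + 1), (adjSwap i h, t i) ∈ K := fun i h => by
    refine Subgroup.subset_closure ⟨i, (Nat.lt_of_succ_lt_succ h : i < m), ?_⟩
    simp only [hs, h, dite_true]
  have hsurj : ∀ σ : Equiv.Perm (Fin (m + 1)), ∃ g, (σ, g) ∈ K := by
    have h1 : (⊤ : Subgroup (Equiv.Perm (Fin (m + 1)))) ≤ K.map (MonoidHom.fst _ G) := by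
      rw [← Subgroup.closure_eq_top_of_mclosure_eq_top
        (Equiv.Perm.mclosure_swap_castSucc_succ m), Subgroup.closure_le]
      rintro _ ⟨i, rfl⟩
      exact ⟨_, hmem i (by omega), rfl⟩
    intro σ
    obtain ⟨⟨a, g⟩, hx, rfl⟩ := h1 (Subgroup.mem_top σ)
    exact ⟨g, hx⟩
  obtain ⟨S, hS, hc⟩ := hu.closure_bound
  have himg : S.image Prod.fst = Finset.univ := by
    refine Finset.eq_univ_of_forall fun σ => ?_
    obtain ⟨g, hg⟩ := hsurj σ
    exact Finset.mem_image.2 ⟨_, hS hg, rfl⟩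
  have hinj : Set.InjOn Prod.fst (S : Set (Equiv.Perm (Fin (m + 1)) × G)) := by
    rw [← Finset.card_image_iff]
    refine le_antisymm Finset.card_image_le ?_
    rw [himg, Finset.card_univ, Fintype.card_perm, Fintype.card_fin]
    exact hc
  let f : K →* Equiv.Perm (Fin (m + 1)) := (MonoidHom.fst _ G).comp K.subtype
  have hf : Function.Bijective f := by
    refine ⟨fun x y h => Subtype.ext (hinj (hS x.2) (hS y.2) h), fun σ => ?_⟩
    obtain ⟨g, hg⟩ := hsurj σ
    exact ⟨⟨_, hg⟩, rfl⟩
  let e := MulEquiv.ofBijective f hf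
  refine ⟨(MonoidHom.snd _ G).comp (K.subtype.comp e.symm.toMonoidHom), fun i h => ?_⟩
  have : e.symm (adjSwap i h) = ⟨_, hmem i h⟩ := by
    rw [MulEquiv.symm_apply_eq]; rfl
  simp [this]

/-- The homomorphism from the symmetric group on `n` letters that sends the `i`-th adjacent
transposition to `t i`. It is unique, since the adjacent transpositions generate. -/
def permHom (n : ℕ) (t : ℕ → G) (ht : IsCoxeterFamily t (n - 1)) : Equiv.Perm (Fin n) →* G :=
  (exists_permHom n t ht).choose

theorem permHom_adjSwap (n : ℕ) (t : ℕ → G) (ht : IsCoxeterFamily t (n - 1)) (i : ℕ)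
    (h : i + 1 < n) : permHom n t ht (adjSwap i h) = t i :=
  (exists_permHom n t ht).choose_spec i h

end Coxeter

/-! ### Unitary `R`-matrices and the action of the symmetric group on tensor powers -/

section RMatrix

variable (k : Type u) [Field k] (V : Type u) [AddCommGroup V] [Module k V]

variable {k V} in
/-- The operator on `V ⊗ (V ⊗ A)` given by `R` on the two left factors. -/
def onHead (R : (V ⊗[k] V) ≃ₗ[k] (V ⊗[k] V)) (A : Type u) [AddCommGroup A] [Module k A] :
    (V ⊗[k] (V ⊗[k] A)) ≃ₗ[k] (V ⊗[k] (V ⊗[k] A)) :=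
  (TensorProduct.assoc k V V A).symm ≪≫ₗ
    TensorProduct.congr R (LinearEquiv.refl k A) ≪≫ₗ TensorProduct.assoc k V V A

variable {k V} in
/-- The operator on `V ⊗ A` given by `f` on the right factor. -/
def onTail {A : Type u} [AddCommGroup A] [Module k A] (f : A ≃ₗ[k] A) :
    (V ⊗[k] A) ≃ₗ[k] (V ⊗[k] A) :=
  TensorProduct.congr (LinearEquiv.refl k V) f

/-- A unitary quantum `R`-matrix on `V`: an automorphism `R` of `V ⊗ V` with `R² = 1` and
`R₁ R₂ R₁ = R₂ R₁ R₂` on `V ⊗ (V ⊗ V)`, where `R₁ = R ⊗ I` and `R₂ = I ⊗ R`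
(the product in `LinearEquiv` automorphisms is composition). -/
structure UnitaryRMatrix where
  toEquiv : (V ⊗[k] V) ≃ₗ[k] (V ⊗[k] V)
  unitary : toEquiv * toEquiv = 1
  yangBaxter : onHead toEquiv V * onTail toEquiv * onHead toEquiv V =
    onTail toEquiv * onHead toEquiv V * onTail toEquiv

/-- The iterated tensor power `V ⊗ (V ⊗ ⋯ (V ⊗ k))` with `n` factors `V`. -/
def tensorPow : ℕ → ModuleCat.{u} k
  | 0 => ModuleCat.of k k
  | n + 1 => ModuleCat.of k (V ⊗[k] tensorPow n)

instance tensorPow_finite [Module.Finite k V] : ∀ n, Module.Finite k (tensorPow k V n)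
  | 0 => inferInstanceAs (Module.Finite k k)
  | n + 1 =>
      have := tensorPow_finite n
      inferInstanceAs (Module.Finite k (V ⊗[k] tensorPow k V n))

variable {k V}

/-- The operator `Rᵢ` on `V^{⊗ n}`: it is `R` on the tensor factors number `i` and `i + 1`
(counted from `0`) and the identity on the others. For `n ≤ i + 1`, where these factors do not
exist, it is the identity. -/
def opAt (R : (V ⊗[k] V) ≃ₗ[k] (V ⊗[k] V)) :
    (n i : ℕ) → (tensorPow k V n ≃ₗ[k] tensorPow k V n)
  | 0, _ => LinearEquiv.refl k _
  | 1, _ => LinearEquiv.refl k _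
  | n + 2, 0 => onHead R (tensorPow k V n)
  | n + 2, i + 1 => onTail (opAt R (n + 1) i)

theorem onTail_mul {A : Type u} [AddCommGroup A] [Module k A] (f g : A ≃ₗ[k] A) :
    onTail (V := V) (f * g) = onTail f * onTail g := by
  ext x
  induction x with
  | zero => simp
  | add x y hx hy => rw [map_add, hx, hy, map_add]
  | tmul x y => simp [onTail]

theorem onTail_one {A : Type u} [AddCommGroup A] [Module k A] :
    onTail (V := V) (1 : A ≃ₗ[k] A) = 1 := by
  ext x
  induction x with
  | zero => simp
  | add x y hx hy => rw [map_add, hx, hy, map_add]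
  | tmul x y => simp [onTail]

theorem onHead_mul (R S : (V ⊗[k] V) ≃ₗ[k] (V ⊗[k] V)) (A : Type u) [AddCommGroup A]
    [Module k A] : onHead R A * onHead S A = onHead (R * S) A := by
  ext x
  obtain ⟨x, rfl⟩ := (TensorProduct.assoc k V V A).surjective x
  induction x with
  | zero => simp
  | add x y hx hy => rw [map_add, map_add, hx, hy, map_add]
  | tmul x y => simp [onHead]

theorem onHead_one (A : Type u) [AddCommGroup A] [Module k A] :
    onHead (1 : (V ⊗[k] V) ≃ₗ[k] (V ⊗[k] V)) A = 1 := by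
  ext x
  obtain ⟨x, rfl⟩ := (TensorProduct.assoc k V V A).surjective x
  induction x with
  | zero => simp
  | add x y hx hy => rw [map_add, map_add, hx, hy, map_add]
  | tmul x y => simp [onHead]

theorem onHead_comm (R : (V ⊗[k] V) ≃ₗ[k] (V ⊗[k] V)) {A : Type u} [AddCommGroup A]
    [Module k A] (f : A ≃ₗ[k] A) :
    onHead R A * onTail (onTail f) = onTail (onTail f) * onHead R A := by
  have key : ∀ (u : V ⊗[k] V) (a : A), onTail (onTail f) (TensorProduct.assoc k V V A (u ⊗ₜ a)) =
      TensorProduct.assoc k V V A (u ⊗ₜ f a) := by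
    intro u a
    induction u with
    | zero => simp
    | add x y hx hy => rw [add_tmul, map_add, map_add, hx, hy, add_tmul, map_add]
    | tmul x y => simp [onTail]
  ext x
  obtain ⟨x, rfl⟩ := (TensorProduct.assoc k V V A).surjective x
  induction x with
  | zero => simp
  | add x y hx hy => rw [map_add, map_add, hx, hy, map_add]
  | tmul x a =>
      rw [LinearEquiv.mul_apply, LinearEquiv.mul_apply, key]
      simp only [onHead, LinearEquiv.trans_apply, LinearEquiv.symm_apply_apply,
        TensorProduct.congr_tmul, LinearEquiv.refl_apply]
      rw [key]

/-- Regrouping of `(V ⊗ (V ⊗ V)) ⊗ A`. -/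
def regroup (A : Type u) [AddCommGroup A] [Module k A] :
    ((V ⊗[k] (V ⊗[k] V)) ⊗[k] A) ≃ₗ[k] (V ⊗[k] (V ⊗[k] (V ⊗[k] A))) :=
  TensorProduct.assoc k V (V ⊗[k] V) A ≪≫ₗ
    TensorProduct.congr (LinearEquiv.refl k V) (TensorProduct.assoc k V V A)

theorem onHead_regroup (R : (V ⊗[k] V) ≃ₗ[k] (V ⊗[k] V)) {A : Type u} [AddCommGroup A]
    [Module k A] (w : V ⊗[k] (V ⊗[k] V)) (a : A) :
    onHead R (V ⊗[k] A) (regroup A (w ⊗ₜ a)) = regroup A (onHead R V w ⊗ₜ a) := by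
  obtain ⟨w, rfl⟩ := (TensorProduct.assoc k V V V).surjective w
  induction w with
  | zero => simp
  | add x y hx hy => simp only [map_add, add_tmul] at hx hy ⊢; rw [hx, hy]
  | tmul u z =>
      have key : ∀ u : V ⊗[k] V, regroup A (TensorProduct.assoc k V V V (u ⊗ₜ z) ⊗ₜ a) =
          TensorProduct.assoc k V V (V ⊗[k] A) (u ⊗ₜ (z ⊗ₜ a)) := by
        intro u
        induction u with
        | zero => simp
        | add x y hx hy => simp only [map_add, add_tmul] at hx hy ⊢; rw [hx, hy]
        | tmul x y => simp [regroup]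
      rw [key]
      simp only [onHead, LinearEquiv.trans_apply, LinearEquiv.symm_apply_apply,
        TensorProduct.congr_tmul, LinearEquiv.refl_apply]
      rw [key]

theorem onTail_regroup (R : (V ⊗[k] V) ≃ₗ[k] (V ⊗[k] V)) {A : Type u} [AddCommGroup A]
    [Module k A] (w : V ⊗[k] (V ⊗[k] V)) (a : A) :
    onTail (onHead R A) (regroup A (w ⊗ₜ a)) = regroup A (onTail R w ⊗ₜ a) := by
  induction w with
  | zero => simp
  | add x y hx hy => simp only [map_add, add_tmul] at hx hy ⊢; rw [hx, hy]
  | tmul x u => simp [onTail, onHead, regroup]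

theorem UnitaryRMatrix.braid (R : UnitaryRMatrix k V) (A : Type u) [AddCommGroup A]
    [Module k A] :
    onHead R.toEquiv (V ⊗[k] A) * onTail (onHead R.toEquiv A) * onHead R.toEquiv (V ⊗[k] A) =
      onTail (onHead R.toEquiv A) * onHead R.toEquiv (V ⊗[k] A) *
        onTail (onHead R.toEquiv A) := by
  ext x
  obtain ⟨x, rfl⟩ := (regroup (k := k) (V := V) A).surjective x
  induction x with
  | zero => simp
  | add x y hx hy => rw [map_add, map_add, hx, hy, map_add]
  | tmul w a =>
      simp only [LinearEquiv.mul_apply, onHead_regroup, onTail_regroup]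
      exact congrArg (fun w => regroup A (w ⊗ₜ a)) (LinearEquiv.congr_fun R.yangBaxter w)

theorem opAt_sq (R : UnitaryRMatrix k V) :
    ∀ n i, opAt R.toEquiv n i * opAt R.toEquiv n i = 1
  | 0, _ => rfl
  | 1, _ => rfl
  | n + 2, 0 => (onHead_mul _ _ _).trans (by rw [R.unitary, onHead_one]; rfl)
  | n + 2, i + 1 => (onTail_mul _ _).symm.trans
      ((congrArg onTail (opAt_sq R (n + 1) i)).trans onTail_one)

theorem opAt_braid (R : UnitaryRMatrix k V) : ∀ n i, i + 2 < n →
    opAt R.toEquiv n i * opAt R.toEquiv n (i + 1) * opAt R.toEquiv n i =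
      opAt R.toEquiv n (i + 1) * opAt R.toEquiv n i * opAt R.toEquiv n (i + 1)
  | 0, _, h => by omega
  | 1, _, h => by omega
  | 2, _, h => by omega
  | n + 3, 0, _ => R.braid (tensorPow k V n)
  | n + 3, i + 1, h => by
      have := congrArg (onTail (V := V)) (opAt_braid R (n + 2) i (by omega))
      simp only [onTail_mul] at this
      exact this

theorem opAt_comm (R : UnitaryRMatrix k V) : ∀ n i j, i + 1 < j →
    opAt R.toEquiv n i * opAt R.toEquiv n j = opAt R.toEquiv n j * opAt R.toEquiv n i
  | 0, _, _, _ => rfl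
  | 1, _, _, _ => rfl
  | _ + 2, _, 0, h => by omega
  | _ + 2, _, 1, h => by omega
  | 2, 0, j + 2, _ => by
      have : opAt R.toEquiv 2 (j + 2) = 1 := onTail_one
      rw [this, one_mul, mul_one]
  | n + 3, 0, j + 2, _ => onHead_comm R.toEquiv (opAt R.toEquiv (n + 1) j)
  | n + 2, i + 1, j + 2, h => by
      have := congrArg (onTail (V := V)) (opAt_comm R (n + 1) i (j + 1) (by omega))
      simp only [onTail_mul] at this
      exact this

theorem opAt_isCoxeterFamily (R : UnitaryRMatrix k V) (n : ℕ) :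
    IsCoxeterFamily (fun i => opAt R.toEquiv n i) (n - 1) where
  sq i _ := opAt_sq R n i
  braid i hi := opAt_braid R n i (by omega)
  comm i j hij _ := opAt_comm R n i j hij

/-- The representation `σ ↦ R_σ` of the symmetric group on `V^{⊗ n}`, in which the adjacent
transposition of the places `i` and `i + 1` acts by `Rᵢ`. -/
def powRep (R : UnitaryRMatrix k V) (n : ℕ) :
    Representation k (Equiv.Perm (Fin n)) (tensorPow k V n) :=
  (LinearEquiv.automorphismGroup.toLinearMapMonoidHom).comp
    (permHom n (fun i => opAt R.toEquiv n i) (opAt_isCoxeterFamily R n))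

theorem powRep_adjSwap (R : UnitaryRMatrix k V) (n i : ℕ) (h : i + 1 < n) :
    powRep R n (adjSwap i h) = (opAt R.toEquiv n i).toLinearMap := by
  unfold powRep
  rw [MonoidHom.comp_apply, permHom_adjSwap]
  rfl

end RMatrix

/-! ### The free tensor category -/

section FreeTensorCat

variable (k : Type u) [Field k]

/-- The objects of finite length among the families `(Mₙ)` of finite-dimensional representations
of the symmetric groups: `Mₙ = 0` for all large `n`. -/
def IsFinitelySupported : ObjectProperty (∀ n : ℕ, FDRep k (Equiv.Perm (Fin n))) :=
  fun M => ∃ N, ∀ n, N ≤ n → Subsingleton (M n)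

/-- The free `k`-linear tensor category: families of finite-dimensional representations `Mₙ` of
the symmetric groups `Sₙ`, `n ≥ 0`, almost all of them zero. -/
abbrev FreeTensorCat := (IsFinitelySupported k).FullSubcategory

/-- The sign representation of `Sₘ` on `k`. -/
def signRep (m : ℕ) : Representation k (Equiv.Perm (Fin m)) k where
  toFun σ := ((Equiv.Perm.sign σ : ℤ) : k) • LinearMap.id
  map_one' := by simp; rfl
  map_mul' σ τ := by ext; simp [mul_comm]

/-- The zero representation. -/
def zeroRep (m : ℕ) : Representation k (Equiv.Perm (Fin m)) PUnit.{u + 1} := 1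

/-- The object `Λⁿ X`: the sign representation of `Sₙ`, placed in degree `n`. -/
def extPower (n : ℕ) : FreeTensorCat k where
  obj m := if m = n then FDRep.of (signRep k m) else FDRep.of (zeroRep k m)
  property := ⟨n + 1, fun m hm => by
    have h : ¬ m = n := by omega
    simp only [h, if_false]
    exact inferInstanceAs (Subsingleton PUnit)⟩

/-- The Hilbert series of a functor: the generating series of the dimensions of the images of
the exterior powers `Λⁿ X`. -/
def hilbertSeries (F : FreeTensorCat k ⥤ FGModuleCat.{u} k) : PowerSeries ℤ :=
  PowerSeries.mk fun n => (Module.finrank k (F.obj (extPower k n)) : ℤ)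

end FreeTensorCat

/-! ### The functor defined by an `R`-matrix -/

section Functor

variable {k : Type u} [Field k] {V : Type u} [AddCommGroup V] [Module k V]

/-- The degree `n` part `V^{⊗ n} ⊗_{k[Sₙ]} Mₙ` of the functor of `R`: the coinvariants of `Sₙ` for
the diagonal action on `V^{⊗ n} ⊗ Mₙ`. -/
abbrev RPart (R : UnitaryRMatrix k V) (n : ℕ) (M : FDRep k (Equiv.Perm (Fin n))) : Type u :=
  Representation.Coinvariants ((powRep R n).tprod M.ρ)

/-- The action of `RPart` on morphisms. -/
def RPart.map (R : UnitaryRMatrix k V) (n : ℕ) {M N : FDRep k (Equiv.Perm (Fin n))}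
    (f : M ⟶ N) : RPart R n M →ₗ[k] RPart R n N :=
  Representation.Coinvariants.map _ _
    ⟨(f.hom.hom.hom).lTensor (tensorPow k V n), fun σ => by
      have h : f.hom.hom.hom ∘ₗ M.ρ σ = N.ρ σ ∘ₗ f.hom.hom.hom :=
        congrArg (fun g => g.hom.hom) (f.comm σ)
      ext v m
      exact congrArg (fun z => powRep R n σ v ⊗ₜ[k] z) (LinearMap.congr_fun h m)⟩

theorem RPart.map_id (R : UnitaryRMatrix k V) (n : ℕ) (M : FDRep k (Equiv.Perm (Fin n))) :
    RPart.map R n (𝟙 M) = LinearMap.id := by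
  apply Representation.Coinvariants.hom_ext
  ext v m
  rfl

theorem RPart.map_comp (R : UnitaryRMatrix k V) (n : ℕ) {L M N : FDRep k (Equiv.Perm (Fin n))}
    (f : L ⟶ M) (g : M ⟶ N) :
    RPart.map R n (f ≫ g) = RPart.map R n g ∘ₗ RPart.map R n f := by
  apply Representation.Coinvariants.hom_ext
  ext v m
  rfl

theorem RPart.subsingleton (R : UnitaryRMatrix k V) (n : ℕ) (M : FDRep k (Equiv.Perm (Fin n)))
    [Subsingleton M] : Subsingleton (RPart R n M) := by
  have : Subsingleton (tensorPow k V n ⊗[k] M) := by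
    refine subsingleton_of_forall_eq 0 fun x => ?_
    induction x with
    | zero => rfl
    | add x y hx hy => rw [hx, hy, add_zero]
    | tmul x y => rw [Subsingleton.elim y 0, tmul_zero]
  exact (Representation.Coinvariants.mk_surjective _).subsingleton

instance RPart.finite_directSum [Module.Finite k V] (R : UnitaryRMatrix k V)
    (M : FreeTensorCat k) : Module.Finite k (⨁ n, RPart R n (M.obj n)) := by
  classical
  obtain ⟨N, hN⟩ := M.property
  let f : (∀ i : Fin N, RPart R i (M.obj i)) →ₗ[k] ⨁ n, RPart R n (M.obj n) :=
    ∑ i : Fin N, DirectSum.lof k ℕ (fun n => RPart R n (M.obj n)) i ∘ₗ LinearMap.proj i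
  refine Module.Finite.of_surjective f fun x => ⟨fun i => x i, ?_⟩
  refine DFinsupp.ext fun n => ?_
  by_cases hn : n < N
  · have h : f (fun i => x i) =
        ∑ i : Fin N, DirectSum.lof k ℕ (fun n => RPart R n (M.obj n)) i (x i) := by
      simp [f]
    rw [h, DFinsupp.finsetSum_apply, Finset.sum_eq_single_of_mem ⟨n, hn⟩ (Finset.mem_univ _)]
    · exact DFinsupp.single_eq_same
    · intro i _ hi
      exact DFinsupp.single_eq_of_ne fun e => hi (Fin.ext e.symm)
  · have := hN n (not_lt.1 hn)
    have := RPart.subsingleton R n (M.obj n)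
    exact Subsingleton.elim _ _

/-- The functor `F_R` defined by the `R`-matrix `R`:
`F_R(M) = ⨁ₙ V^{⊗ n} ⊗_{k[Sₙ]} Mₙ`. -/
def functorOf [Module.Finite k V] (R : UnitaryRMatrix k V) :
    FreeTensorCat k ⥤ FGModuleCat.{u} k where
  obj M := FGModuleCat.of k (⨁ n, RPart R n (M.obj n))
  map f := FGModuleCat.ofHom (DirectSum.lmap fun n => RPart.map R n (f.hom n))
  map_id M := by
    apply FGModuleCat.hom_ext
    apply LinearMap.ext
    intro x
    exact DFinsupp.ext fun n => LinearMap.congr_fun (RPart.map_id R n (M.obj n)) (x n)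
  map_comp f g := by
    apply FGModuleCat.hom_ext
    apply LinearMap.ext
    intro x
    exact DFinsupp.ext fun n => LinearMap.congr_fun (RPart.map_comp R n (f.hom n) (g.hom n)) (x n)

end Functor

end FreeTensor

end

/-! In each degree `n` the functor depends only on the representation of `S_n` on `V^{⊗n}`. In
characteristic zero that representation is determined by its character `χ_n`
(`nonempty_equiv_of_character_eq`). So it suffices to recover all `χ_n` from the Hilbert series. The
converse is immediate, since isomorphic functors take values of equal dimension on `Λⁿ X`.

Concatenation identifies `V^{⊗a} ⊗ V^{⊗b}` with the restriction of `V^{⊗(a+b)}` to `S_a × S_b`, so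
characters are multiplicative on juxtaposed permutations (`character_powRep_blockPerm`). Hence `χ_n`
at a permutation with several orbits is determined by the `χ_m` with `m < n`. The `n`-th coefficient
of the Hilbert series is the average of `sgn(σ) χ_n(σ)` over `S_n`
(`card_mul_finrank_functorOf_extPower`). By induction its only unknown part comes from the
`n`-cycles. These form one conjugacy class, with constant sign, so they contribute a nonzero
multiple of a single value of `χ_n`, and the coefficient determines that value
(`character_powRep_eq`). -/

namespace Representation

/-! ### Characters and coinvariants of finite groups in characteristic zero -/

section CharacterDeterminesRep

variable {k G : Type*} [Field k] [Group G]

section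

variable {V W : Type*} [AddCommGroup V] [Module k V] [AddCommGroup W] [Module k W]
  {ρ : Representation k G V} {σ : Representation k G W}

/-- A representation is the direct sum of two complementary subrepresentations. -/
noncomputable def prodEquivOfIsCompl (p q : Subrepresentation ρ) (h : IsCompl p q) :
    (p.toRepresentation.prod q.toRepresentation).Equiv ρ :=
  .mk (Submodule.prodEquivOfIsCompl p.toSubmodule q.toSubmodule
    (IsCompl.of_eq (congrArg Subrepresentation.toSubmodule h.inf_eq_bot)
      (congrArg Subrepresentation.toSubmodule h.sup_eq_top))) fun g => by
    ext x <;> simp [prod, Subrepresentation.toRepresentation]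

theorem character_prod [FiniteDimensional k V] [FiniteDimensional k W] (g : G) :
    (ρ.prod σ).character g = ρ.character g + σ.character g :=
  LinearMap.trace_prodMap' (ρ g) (σ g)

/-- The direct sum of two equivalences of representations. -/
noncomputable def prodCongr {V' W' : Type*} [AddCommGroup V'] [Module k V'] [AddCommGroup W']
    [Module k W'] {ρ' : Representation k G V'} {σ' : Representation k G W'}
    (e : ρ.Equiv ρ') (f : σ.Equiv σ') : (ρ.prod σ).Equiv (ρ'.prod σ') :=
  .mk (e.toLinearEquiv.prodCongr f.toLinearEquiv) fun g => by
    apply LinearMap.ext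
    intro x
    exact Prod.ext (LinearMap.congr_fun (e.isIntertwining' g) x.1)
      (LinearMap.congr_fun (f.isIntertwining' g) x.2)

/-- A complement of the kernel of an intertwining map is equivalent to the range. -/
theorem nonempty_equiv_range (f : ρ.IntertwiningMap σ) (C : Subrepresentation ρ)
    (h : IsCompl f.ker C) : Nonempty (C.toRepresentation.Equiv f.range.toRepresentation) := by
  let g : C.toRepresentation.IntertwiningMap f.range.toRepresentation :=
    ⟨(f.toLinearMap.domRestrict C.toSubmodule).codRestrict f.range.toSubmodule
      (fun x => ⟨x, rfl⟩), fun γ => by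
        ext x
        exact IntertwiningMap.isIntertwining _ _ f γ x⟩
  refine ⟨g.ofBijective ⟨?_, ?_⟩⟩
  · refine (injective_iff_map_eq_zero g).2 fun x hx => ?_
    have h1 : (x : V) ∈ f.ker ⊓ C := ⟨congrArg Subtype.val hx, x.2⟩
    rw [h.inf_eq_bot] at h1
    exact Subtype.ext h1
  · rintro ⟨_, v, rfl⟩
    have hv : v ∈ (f.ker ⊔ C).toSubmodule := by rw [h.sup_eq_top]; trivial
    obtain ⟨a, ha, c, hc, rfl⟩ := Submodule.mem_sup.1 hv
    refine ⟨⟨c, hc⟩, Subtype.ext ?_⟩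
    have ha' : f a = 0 := ha
    change f c = f (a + c)
    rw [map_add, ha', zero_add]

end

/-- Over a field of characteristic zero, finite-dimensional representations of a finite group with
the same character are equivalent. -/
theorem nonempty_equiv_of_character_eq [CharZero k] [Finite G] {V W : Type*}
    [AddCommGroup V] [Module k V] [FiniteDimensional k V]
    [AddCommGroup W] [Module k W] [FiniteDimensional k W]
    (ρ : Representation k G V) (σ : Representation k G W)
    (h : ∀ g, ρ.character g = σ.character g) : Nonempty (ρ.Equiv σ) := by
  have := Fintype.ofFinite G
  have hG : (Nat.card G : k) ≠ 0 := Nat.cast_ne_zero.2 Nat.card_pos.ne'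
  have : NeZero (Nat.card G : k) := ⟨hG⟩
  let : Invertible (Nat.card G : k) := invertibleOfNonzero hG
  -- Induction on `dim V`: a nonzero intertwiner `f` has isomorphic pieces, a complement of its
  -- kernel and its range. Splitting them off leaves `ker f` and a complement of the range, again
  -- with equal characters.
  induction hn : Module.finrank k V using Nat.strong_induction_on generalizing V W with
  | _ n ih =>
  have hVW : Module.finrank k V = Module.finrank k W := by
    have := h 1
    rw [char_one, char_one] at this
    exact_mod_cast this
  rcases subsingleton_or_nontrivial V with hV | hV
  · have hW : Subsingleton W := by
      rw [← Module.finrank_zero_iff (R := k), ← hVW, Module.finrank_zero_iff]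
      exact hV
    exact ⟨.mk (LinearEquiv.ofFinrankEq V W hVW) fun g =>
      LinearMap.ext fun x => Subsingleton.elim _ _⟩
  obtain ⟨f, hf⟩ : ∃ f : ρ.IntertwiningMap σ, f ≠ 0 := by
    -- Both dimensions are given by the same pairing of characters, and the left one is positive
    -- because of the identity map.
    have h1 : Module.finrank k (ρ.IntertwiningMap ρ) = Module.finrank k (ρ.IntertwiningMap σ) := by
      have e1 := card_inv_mul_sum_char_mul_char_eq_finrank ρ ρ
      have e2 := card_inv_mul_sum_char_mul_char_eq_finrank ρ σ
      simp only [← h] at e2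
      exact_mod_cast e1.symm.trans e2
    have h2 : Nontrivial (ρ.IntertwiningMap ρ) := by
      obtain ⟨v, hv⟩ := exists_ne (0 : V)
      exact ⟨.id ρ, 0, fun e => hv (congrArg (fun f : ρ.IntertwiningMap ρ => f v) e)⟩
    have h3 : Nontrivial (ρ.IntertwiningMap σ) := by
      rw [← Module.finrank_pos_iff (R := k), ← h1, Module.finrank_pos_iff]
      exact h2
    exact exists_ne 0
  obtain ⟨C, hC⟩ := exists_isCompl f.ker
  obtain ⟨D, hD⟩ := exists_isCompl f.range
  obtain ⟨e⟩ := nonempty_equiv_range f C hC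
  have hlt : Module.finrank k f.ker.toSubmodule < n := by
    rw [← hn]
    refine Submodule.finrank_lt fun htop => hf ?_
    ext v
    have : v ∈ f.ker.toSubmodule := by rw [htop]; trivial
    exact this
  obtain ⟨e'⟩ := ih _ hlt f.ker.toRepresentation D.toRepresentation (fun g => by
    have h1 := congrFun (char_iso (prodEquivOfIsCompl _ _ hC)) g
    have h2 := congrFun (char_iso (prodEquivOfIsCompl _ _ hD)) g
    rw [character_prod] at h1 h2
    rw [← congrFun (char_iso e) g, ← h g, ← h1, add_comm] at h2
    exact (add_right_cancel h2).symm) rfl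
  exact ⟨(prodEquivOfIsCompl _ _ hC).symm.trans
    ((prodCongr e' e).trans (prodEquivOfIsCompl _ _ hD.symm))⟩

/-- The space of coinvariants of a finite group has the dimension of the space of invariants. -/
theorem finrank_coinvariants_eq_finrank_invariants [CharZero k] [Finite G] {V : Type*}
    [AddCommGroup V] [Module k V] (ρ : Representation k G V) :
    Module.finrank k ρ.Coinvariants = Module.finrank k ρ.invariants := by
  have := Fintype.ofFinite G
  have hG : (Fintype.card G : k) ≠ 0 := Nat.cast_ne_zero.2 Fintype.card_ne_zero
  let : Invertible (Fintype.card G : k) := invertibleOfNonzero hG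
  have hav : ∀ v, averageMap ρ v = (Fintype.card G : k)⁻¹ • ∑ g, ρ g v := by
    intro v
    simp [GroupAlgebra.average]
  -- Averaging descends to a map `p` on coinvariants. It fixes invariants, so `f` is injective;
  -- averaging does not change the class of a vector, so `f` is surjective.
  let f : ρ.invariants →ₗ[k] ρ.Coinvariants := Coinvariants.mk ρ ∘ₗ ρ.invariants.subtype
  let p : ρ.Coinvariants →ₗ[k] V := Coinvariants.lift ρ ρ.averageMap fun g => by
    ext v
    simp only [LinearMap.comp_apply, hav, ← Module.End.mul_apply, ← map_mul]
    rw [Fintype.sum_equiv (Equiv.mulRight g) (fun x => ρ (x * g) v) (fun x => ρ x v)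
      fun _ => rfl]
  refine (LinearEquiv.ofBijective f ⟨fun x y hxy => ?_, fun x => ?_⟩).finrank_eq.symm
  · have h1 : p (f x) = p (f y) := by rw [hxy]
    have h2 : ∀ x, p (f x) = x := fun x => averageMap_id ρ _ x.2
    exact Subtype.ext (by rw [← h2, h1, h2])
  · obtain ⟨v, rfl⟩ := Coinvariants.mk_surjective ρ x
    refine ⟨⟨_, averageMap_invariant ρ v⟩, ?_⟩
    change Coinvariants.mk ρ (averageMap ρ v) = _
    rw [hav, map_smul, map_sum]
    simp only [Coinvariants.mk_self_apply, Finset.sum_const, Finset.card_univ]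
    rw [← Nat.cast_smul_eq_nsmul k, smul_smul, inv_mul_cancel₀ hG, one_smul]

end CharacterDeterminesRep

end Representation

namespace FreeTensor

/-! ### Multiplicativity of the characters of the tensor powers -/

/-! ### Adjacent transpositions, juxtaposition and conjugacy of permutations -/

section Permutations

/-- The action `powRep` is known explicitly only on adjacent transpositions, so statements about it
are proved along words in these generators. -/
theorem perm_adjSwap_induction {n : ℕ} {P : Equiv.Perm (Fin n) → Prop} (one : P 1)
    (mul_left : ∀ i (h : i + 1 < n) σ, P σ → P (adjSwap i h * σ)) (σ : Equiv.Perm (Fin n)) :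
    P σ := by
  obtain _ | m := n
  · rwa [Subsingleton.elim σ 1]
  have hσ : σ ∈ Submonoid.closure
      (Set.range fun i : Fin m => Equiv.swap i.castSucc i.succ) := by
    rw [Equiv.Perm.mclosure_swap_castSucc_succ]
    trivial
  induction hσ using Submonoid.closure_induction_left with
  | one => exact one
  | mul_left x hx y _ ih =>
    obtain ⟨i, rfl⟩ := hx
    exact mul_left i (by omega) y ih

/-- The first `a` letters, followed by the last `b` letters. -/
def blockEquiv (a b : ℕ) : Fin a ⊕ Fin b ≃ Fin (b + a) :=
  finSumFinEquiv.trans (finCongr (add_comm a b))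

/-- The juxtaposition of a permutation of the first `a` letters and one of the last `b`. -/
def blockPerm {a b : ℕ} (σ : Equiv.Perm (Fin a)) (τ : Equiv.Perm (Fin b)) :
    Equiv.Perm (Fin (b + a)) :=
  (blockEquiv a b).permCongr (Equiv.Perm.sumCongr σ τ)

variable {a b : ℕ}

theorem blockPerm_one : blockPerm (1 : Equiv.Perm (Fin a)) (1 : Equiv.Perm (Fin b)) = 1 := by
  ext x
  simp [blockPerm]

theorem blockPerm_mul (σ σ' : Equiv.Perm (Fin a)) (τ τ' : Equiv.Perm (Fin b)) :
    blockPerm (σ * σ') (τ * τ') = blockPerm σ τ * blockPerm σ' τ' := by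
  rw [blockPerm, ← Equiv.Perm.sumCongr_mul]
  exact map_mul (blockEquiv a b).permCongrHom _ _

theorem blockPerm_adjSwap_left (i : ℕ) (h : i + 1 < a) :
    blockPerm (adjSwap i h) (1 : Equiv.Perm (Fin b)) = adjSwap i (by omega) := by
  rw [blockPerm, adjSwap, Equiv.Perm.sumCongr_swap_one]
  refine (Equiv.symm_trans_swap_trans _ _ _).trans ?_
  rfl

theorem blockPerm_adjSwap_right (j : ℕ) (h : j + 1 < b) :
    blockPerm (1 : Equiv.Perm (Fin a)) (adjSwap j h) = adjSwap (j + a) (by omega) := by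
  rw [blockPerm, adjSwap, Equiv.Perm.sumCongr_one_swap]
  refine (Equiv.symm_trans_swap_trans _ _ _).trans ?_
  unfold adjSwap
  congr 1 <;> ext <;> simp [blockEquiv] <;> omega

/-- A permutation that preserves a set of letters is conjugate to a juxtaposition. -/
theorem exists_isConj_blockPerm {a b : ℕ} (σ : Equiv.Perm (Fin (b + a)))
    (p : Fin (b + a) → Prop) (hp : ∀ x, p (σ x) ↔ p x)
    (e : {x // p x} ≃ Fin a) (f : {x // ¬ p x} ≃ Fin b) :
    ∃ σ₁ σ₂, IsConj σ (blockPerm σ₁ σ₂) := by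
  classical
  refine ⟨e.permCongr (σ.subtypePerm hp), f.permCongr (σ.subtypePerm fun x => (hp x).not),
    isConj_iff.2 ⟨(Equiv.sumCompl p).symm.trans ((Equiv.sumCongr e f).trans (blockEquiv a b)),
      ?_⟩⟩
  rw [mul_inv_eq_iff_eq_mul]
  apply Equiv.ext
  intro x
  obtain ⟨x, rfl⟩ := (Equiv.sumCompl p).surjective x
  rcases x with x | x
  · have : (Equiv.sumCompl p).symm (σ x) = Sum.inl (σ.subtypePerm hp x) :=
      (Equiv.symm_apply_eq _).2 rfl
    simp [blockPerm]
    rw [this]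
    rfl
  · have : (Equiv.sumCompl p).symm (σ x) =
        Sum.inr (σ.subtypePerm (fun x => (hp x).not) x) := (Equiv.symm_apply_eq _).2 rfl
    simp [blockPerm]
    rw [this]
    rfl

/-- Permutations with a single orbit are conjugate. -/
theorem isConj_of_forall_sameCycle {α : Type*} [Fintype α] [DecidableEq α] {σ τ : Equiv.Perm α}
    (x : α) (hσ : ∀ y, σ.SameCycle x y) (hτ : ∀ y, τ.SameCycle x y) : IsConj σ τ := by
  rcases subsingleton_or_nontrivial α with h | h
  · rw [Subsingleton.elim σ τ]
  -- With at least two letters, a single orbit excludes fixed points, so the permutation is a cycle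
  -- of full support. Cycles with supports of equal size are conjugate.
  have key : ∀ ρ : Equiv.Perm α, (∀ y, ρ.SameCycle x y) → ρ.IsCycle ∧ ρ.support = Finset.univ := by
    intro ρ hρ
    have hfix : ∀ y, ρ y ≠ y := by
      intro y hy
      obtain ⟨z, hz⟩ := exists_ne y
      have h1 : ρ.SameCycle y z := (hρ y).symm.trans (hρ z)
      exact hz (h1.eq_of_left hy).symm
    exact ⟨⟨x, hfix x, fun y _ => hρ y⟩, Finset.eq_univ_of_forall fun y =>
      Equiv.Perm.mem_support.2 (hfix y)⟩
  exact (key σ hσ).1.isConj (key τ hτ).1 (by rw [(key σ hσ).2, (key τ hτ).2])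

end Permutations

/-! ### Concatenation of tensor powers -/

section Multiplicativity

variable {k : Type u} [Field k] {V : Type u} [AddCommGroup V] [Module k V]

/-- The isomorphism `(V ⊗ A) ⊗ B ≃ V ⊗ C` induced by an isomorphism `A ⊗ B ≃ C`. -/
noncomputable def consMul {A B C : Type u} [AddCommGroup A] [Module k A] [AddCommGroup B]
    [Module k B] [AddCommGroup C] [Module k C] (e : (A ⊗[k] B) ≃ₗ[k] C) :
    ((V ⊗[k] A) ⊗[k] B) ≃ₗ[k] (V ⊗[k] C) :=
  TensorProduct.assoc k V A B ≪≫ₗ TensorProduct.congr (LinearEquiv.refl k V) e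

section consMul

variable {A B C : Type u} [AddCommGroup A] [Module k A] [AddCommGroup B]
    [Module k B] [AddCommGroup C] [Module k C] (e : (A ⊗[k] B) ≃ₗ[k] C)

theorem consMul_tmul (v : V) (x : A) (y : B) :
    consMul e ((v ⊗ₜ x) ⊗ₜ y) = v ⊗ₜ[k] e (x ⊗ₜ y) := rfl

/-- Having both `y` and `y'` covers two uses: an operator in the left block (`y' = y`) and one in
the right block (`f = 1`). -/
theorem onTail_consMul (f : A ≃ₗ[k] A) (g : C ≃ₗ[k] C) (y y' : B)
    (h : ∀ x, g (e (x ⊗ₜ y)) = e (f x ⊗ₜ y')) (x : V ⊗[k] A) :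
    onTail g (consMul e (x ⊗ₜ y)) = consMul e (onTail f x ⊗ₜ y') := by
  induction x with
  | zero => simp
  | add u w hu hw => simp only [add_tmul, map_add, hu, hw]
  | tmul v x => simp [onTail, consMul_tmul, h]

theorem onHead_consMul (R : (V ⊗[k] V) ≃ₗ[k] (V ⊗[k] V)) (x : V ⊗[k] (V ⊗[k] A)) (y : B) :
    onHead R C (consMul (consMul e) (x ⊗ₜ y)) = consMul (consMul e) (onHead R A x ⊗ₜ y) := by
  -- Since `R` does not preserve pure tensors, `u` stays a general element of `V ⊗ V`; the identity
  -- is used at `u` and at `R u`.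
  have key : ∀ (u : V ⊗[k] V) (z : A),
      consMul (consMul e) (TensorProduct.assoc k V V A (u ⊗ₜ z) ⊗ₜ y) =
        TensorProduct.assoc k V V C (u ⊗ₜ e (z ⊗ₜ y)) := by
    intro u z
    induction u with
    | zero => simp
    | add u w hu hw => simp only [add_tmul, map_add, hu, hw]
    | tmul u w => simp [consMul_tmul]
  obtain ⟨x, rfl⟩ := (TensorProduct.assoc k V V A).surjective x
  induction x with
  | zero => simp
  | add u w hu hw => simp only [add_tmul, map_add, hu, hw]
  | tmul u z =>
    rw [key]
    simp only [onHead, LinearEquiv.trans_apply, LinearEquiv.symm_apply_apply,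
      TensorProduct.congr_tmul, LinearEquiv.refl_apply]
    rw [key]

end consMul

variable (k V) in
/-- The concatenation `V^{⊗ a} ⊗ V^{⊗ b} ≃ V^{⊗ (b + a)}`. -/
noncomputable def tensorPowMul (b : ℕ) :
    (a : ℕ) → (tensorPow k V a ⊗[k] tensorPow k V b) ≃ₗ[k] tensorPow k V (b + a)
  | 0 => TensorProduct.lid k (tensorPow k V b)
  -- Here `b + (a + 1)` is by definition `(b + a) + 1`, which is why the total degree is written `b
  -- + a` throughout.
  | a + 1 => consMul (tensorPowMul b a)

/-- Definitional except for `n = 0`, where both `opAt` terms are the default identity. -/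
theorem opAt_succ (R : (V ⊗[k] V) ≃ₗ[k] (V ⊗[k] V)) :
    ∀ n i, opAt R (n + 1) (i + 1) = onTail (opAt R n i)
  | 0, _ => onTail_one.symm
  | _ + 1, _ => rfl

theorem opAt_tensorPowMul_left (R : (V ⊗[k] V) ≃ₗ[k] (V ⊗[k] V)) (b : ℕ) :
    ∀ (a i : ℕ), i + 1 < a → ∀ (x : tensorPow k V a) (y : tensorPow k V b),
      opAt R (b + a) i (tensorPowMul k V b a (x ⊗ₜ y)) =
        tensorPowMul k V b a (opAt R a i x ⊗ₜ y)
  | 0, _, h => by omega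
  | 1, _, h => by omega
  | a + 2, 0, _ => onHead_consMul (tensorPowMul k V b a) R
  | a + 2, i + 1, h => fun x y =>
      onTail_consMul (tensorPowMul k V b (a + 1)) (opAt R (a + 1) i) (opAt R (b + (a + 1)) i) y y
        (fun x => opAt_tensorPowMul_left R b (a + 1) i (by omega) x y) x

theorem opAt_tensorPowMul_right (R : (V ⊗[k] V) ≃ₗ[k] (V ⊗[k] V)) (b j : ℕ) :
    ∀ (a : ℕ) (x : tensorPow k V a) (y : tensorPow k V b),
      opAt R (b + a) (j + a) (tensorPowMul k V b a (x ⊗ₜ y)) =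
        tensorPowMul k V b a (x ⊗ₜ opAt R b j y)
  -- The zeroth tensor power is `k` and concatenation is scalar multiplication, so the claim is
  -- linearity.
  | 0, c, y => (opAt R b j).map_smul (show k from c) y
  | a + 1, x, y => by
      have h := onTail_consMul (V := V) (tensorPowMul k V b a) 1 (opAt R (b + a) (j + a)) y
        (opAt R b j y) (fun x => opAt_tensorPowMul_right R b j a x y) x
      rw [onTail_one] at h
      exact (LinearEquiv.congr_fun (opAt_succ R (b + a) (j + a)) _).trans h

theorem powRep_blockPerm (R : UnitaryRMatrix k V) {a b : ℕ} (σ : Equiv.Perm (Fin a))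
    (τ : Equiv.Perm (Fin b)) (x : tensorPow k V a) (y : tensorPow k V b) :
    powRep R (b + a) (blockPerm σ τ) (tensorPowMul k V b a (x ⊗ₜ y)) =
      tensorPowMul k V b a (powRep R a σ x ⊗ₜ powRep R b τ y) := by
  induction σ using perm_adjSwap_induction with
  | one =>
    induction τ using perm_adjSwap_induction with
    | one => rw [blockPerm_one, map_one, map_one, map_one]; rfl
    | mul_left j h τ ih =>
      -- Writing the left factor as `1 * 1` lets the generator split off from the juxtaposition.
      rw [← one_mul (1 : Equiv.Perm (Fin a)), blockPerm_mul, map_mul, Module.End.mul_apply, one_mul,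
        ih, blockPerm_adjSwap_right, powRep_adjSwap, map_mul (powRep R b), powRep_adjSwap]
      exact opAt_tensorPowMul_right R.toEquiv b j a _ _
  | mul_left i h σ ih =>
    rw [← one_mul τ, blockPerm_mul, map_mul, Module.End.mul_apply, one_mul,
      ih, blockPerm_adjSwap_left, powRep_adjSwap, map_mul (powRep R a), powRep_adjSwap]
    exact opAt_tensorPowMul_left R.toEquiv b a i h _ _

/-- Concatenation conjugates the tensor product of the two actions into the action of the
juxtaposition, and the trace of a tensor product is the product of the traces. -/
theorem character_powRep_blockPerm [Module.Finite k V] (R : UnitaryRMatrix k V) {a b : ℕ}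
    (σ : Equiv.Perm (Fin a)) (τ : Equiv.Perm (Fin b)) :
    (powRep R (b + a)).character (blockPerm σ τ) =
      (powRep R a).character σ * (powRep R b).character τ := by
  have h : powRep R (b + a) (blockPerm σ τ) =
      (tensorPowMul k V b a).conj (TensorProduct.map (powRep R a σ) (powRep R b τ)) := by
    apply LinearMap.ext
    intro z
    obtain ⟨z, rfl⟩ := (tensorPowMul k V b a).surjective z
    rw [LinearEquiv.conj_apply_apply, LinearEquiv.symm_apply_apply]
    induction z with
    | zero => simp
    | add u w hu hw => simp only [map_add, hu, hw]
    | tmul x y => exact powRep_blockPerm R σ τ x y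
  rw [Representation.character, h, LinearMap.trace_conj']
  exact LinearMap.trace_tensorProduct' _ _

theorem character_powRep_of_isConj (R : UnitaryRMatrix k V) {n : ℕ} {σ τ : Equiv.Perm (Fin n)}
    (h : IsConj σ τ) : (powRep R n).character σ = (powRep R n).character τ := by
  obtain ⟨c, rfl⟩ := isConj_iff.1 h
  rw [Representation.char_conj]

end Multiplicativity

end FreeTensor

namespace FreeTensor

/-! ### The Hilbert series determines the characters -/

section Hilbert

variable {k : Type u} [Field k]

theorem subsingleton_extPower_obj {m n : ℕ} (h : m ≠ n) :
    Subsingleton ((extPower k n).obj m) := by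
  simp only [extPower, h, if_false]
  exact inferInstanceAs (Subsingleton PUnit)

variable {V : Type u} [AddCommGroup V] [Module k V] [FiniteDimensional k V]

/-- The direct sum collapses to its degree `n` summand, since `Λⁿ X` vanishes in all other degrees.
-/
theorem finrank_functorOf_extPower (R : UnitaryRMatrix k V) (n : ℕ) :
    Module.finrank k ((functorOf R).obj (extPower k n)) =
      Module.finrank k ((powRep R n).tprod (signRep k n)).Coinvariants := by
  have h1 : Module.finrank k (⨁ m, RPart R m ((extPower k n).obj m)) =
      Module.finrank k (RPart R n ((extPower k n).obj n)) := by
    refine (LinearEquiv.ofBijective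
      (DirectSum.component k ℕ (fun m => RPart R m ((extPower k n).obj m)) n)
      ⟨fun x y hxy => DFinsupp.ext fun m => ?_, fun x => ⟨DirectSum.lof k ℕ _ n x, ?_⟩⟩).finrank_eq
    · by_cases hm : m = n
      · subst hm
        exact hxy
      · have := subsingleton_extPower_obj (k := k) hm
        have := RPart.subsingleton R m ((extPower k n).obj m)
        exact Subsingleton.elim _ _
    · exact DirectSum.component.lof_self (M := fun m => RPart R m ((extPower k n).obj m)) k n x
  have h2 : (extPower k n).obj n = FDRep.of (signRep k n) := if_pos rfl
  rw [h2] at h1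
  exact h1

theorem character_signRep (n : ℕ) (σ : Equiv.Perm (Fin n)) :
    (signRep k n).character σ = ((Equiv.Perm.sign σ : ℤ) : k) := by
  change LinearMap.trace k k (((Equiv.Perm.sign σ : ℤ) : k) • LinearMap.id) = _
  simp

/-- The coinvariants have the dimension of the invariants, which is the average of the character of
`V^{⊗n} ⊗ sgn`. -/
theorem card_mul_finrank_functorOf_extPower [CharZero k] (R : UnitaryRMatrix k V) (n : ℕ) :
    (Nat.card (Equiv.Perm (Fin n)) : k) *
        Module.finrank k ((functorOf R).obj (extPower k n)) =
      ∑ σ, (powRep R n).character σ * ((Equiv.Perm.sign σ : ℤ) : k) := by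
  have hG : (Nat.card (Equiv.Perm (Fin n)) : k) ≠ 0 := Nat.cast_ne_zero.2 Nat.card_pos.ne'
  let : Invertible (Nat.card (Equiv.Perm (Fin n)) : k) := invertibleOfNonzero hG
  rw [finrank_functorOf_extPower, Representation.finrank_coinvariants_eq_finrank_invariants,
    ← Representation.card_inv_mul_sum_char_eq_finrank, mul_inv_cancel_left₀ hG]
  simp [character_signRep]

variable {W : Type u} [AddCommGroup W] [Module k W] [FiniteDimensional k W]

/-- Characters that agree in smaller degrees agree on the permutations with several orbits. -/
theorem character_powRep_eq_of_not_sameCycle (R : UnitaryRMatrix k V) (S : UnitaryRMatrix k W)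
    {n : ℕ} (ih : ∀ m < n, ∀ σ, (powRep R m).character σ = (powRep S m).character σ)
    (σ : Equiv.Perm (Fin n)) (x y : Fin n) (h : ¬ σ.SameCycle x y) :
    (powRep R n).character σ = (powRep S n).character σ := by
  obtain ⟨a, ⟨e⟩⟩ := Finite.exists_equiv_fin {z // σ.SameCycle x z}
  obtain ⟨b, ⟨f⟩⟩ := Finite.exists_equiv_fin {z // ¬ σ.SameCycle x z}
  -- The orbit of `x` and its complement are both nonempty, so both sizes are less than `n` and `ih`
  -- applies to each block.
  have ha : 0 < a := Fin.pos (e ⟨x, Equiv.Perm.SameCycle.refl σ x⟩)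
  have hb : 0 < b := Fin.pos (f ⟨y, h⟩)
  classical
  obtain rfl : n = b + a := by
    have := Fintype.card_congr
      ((Equiv.sumCompl fun z => σ.SameCycle x z).symm.trans (Equiv.sumCongr e f))
    simp only [Fintype.card_fin, Fintype.card_sum] at this
    omega
  obtain ⟨σ₁, σ₂, hσ⟩ := exists_isConj_blockPerm σ (fun z => σ.SameCycle x z)
    (fun z => Equiv.Perm.sameCycle_apply_right) e f
  rw [character_powRep_of_isConj R hσ, character_powRep_of_isConj S hσ,
    character_powRep_blockPerm, character_powRep_blockPerm, ih a (by omega), ih b (by omega)]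

/-- The alternating sums of the characters of all degrees determine the characters. -/
theorem character_powRep_eq [CharZero k] (R : UnitaryRMatrix k V) (S : UnitaryRMatrix k W)
    (h : ∀ n, ∑ σ, (powRep R n).character σ * ((Equiv.Perm.sign σ : ℤ) : k) =
      ∑ σ, (powRep S n).character σ * ((Equiv.Perm.sign σ : ℤ) : k)) (n : ℕ)
    (σ : Equiv.Perm (Fin n)) : (powRep R n).character σ = (powRep S n).character σ := by
  induction n using Nat.strong_induction_on with
  | _ n ih =>
  -- In degree zero both tensor powers are `k`; in positive degree the letter `0` is available as a
  -- base point for orbits.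
  obtain _ | n := n
  · rw [Subsingleton.elim σ 1, Representation.char_one, Representation.char_one]
    rfl
  by_cases hσ : ∀ y, σ.SameCycle 0 y
  swap
  · push Not at hσ
    obtain ⟨y, hy⟩ := hσ
    exact character_powRep_eq_of_not_sameCycle R S ih σ 0 y hy
  classical
  -- In the difference of the two alternating sums the terms outside `s` cancel by induction and
  -- those in `s` are all equal. What remains is `|s| · sgn σ` times the difference of the
  -- characters at `σ`, and `|s|` is nonzero in `k` because `σ ∈ s`.
  set s : Finset (Equiv.Perm (Fin (n + 1))) := {τ | ∀ y, τ.SameCycle 0 y} with hs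
  have hconj : ∀ τ ∈ s, IsConj τ σ := fun τ hτ =>
    isConj_of_forall_sameCycle 0 (Finset.mem_filter.1 hτ).2 hσ
  have hsign : ∀ τ ∈ s, Equiv.Perm.sign τ = Equiv.Perm.sign σ := fun τ hτ =>
    isConj_iff_eq.1 (Equiv.Perm.sign.map_isConj (hconj τ hτ))
  have hsum := sub_eq_zero.2 (h (n + 1))
  rw [← Finset.sum_sub_distrib, ← Finset.sum_subset (Finset.subset_univ s), Finset.sum_congr rfl
    (g := fun _ => ((powRep R (n + 1)).character σ - (powRep S (n + 1)).character σ) *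
      ((Equiv.Perm.sign σ : ℤ) : k)), Finset.sum_const, nsmul_eq_mul] at hsum
  · have hcard : (s.card : k) ≠ 0 :=
      Nat.cast_ne_zero.2 (Finset.card_ne_zero.2 ⟨σ, Finset.mem_filter.2 ⟨Finset.mem_univ _, hσ⟩⟩)
    have hsgn : ((Equiv.Perm.sign σ : ℤ) : k) ≠ 0 := Int.cast_ne_zero.2 (Units.ne_zero _)
    exact sub_eq_zero.1 ((mul_eq_zero.1 ((mul_eq_zero.1 hsum).resolve_left hcard)).resolve_right
      hsgn)
  · intro τ hτ
    rw [character_powRep_of_isConj R (hconj τ hτ), character_powRep_of_isConj S (hconj τ hτ),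
      hsign τ hτ, sub_mul]
  · intro τ _ hτ
    have : ∃ y, ¬ τ.SameCycle 0 y := by simpa [hs] using hτ
    obtain ⟨y, hy⟩ := this
    rw [character_powRep_eq_of_not_sameCycle R S ih τ 0 y hy, sub_self]

end Hilbert

/-! ### From equivalent tensor powers to isomorphic functors -/

section Isomorphism

variable {k : Type u} [Field k] {V W : Type u} [AddCommGroup V] [Module k V]
  [AddCommGroup W] [Module k W]

/-- Equivalent representations have isomorphic coinvariants after tensoring with `M`. -/
noncomputable def RPart.congr {R : UnitaryRMatrix k V} {S : UnitaryRMatrix k W} {n : ℕ}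
    (e : (powRep R n).Equiv (powRep S n)) (M : FDRep k (Equiv.Perm (Fin n))) :
    RPart R n M ≃ₗ[k] RPart S n M :=
  .ofLinearMap
    (Representation.Coinvariants.map _ _ (e.toIntertwiningMap.rTensor M.ρ))
    (Representation.Coinvariants.map _ _ (e.symm.toIntertwiningMap.rTensor M.ρ))
    (by
      apply Representation.Coinvariants.hom_ext
      ext v m
      exact congrArg (fun z => Representation.Coinvariants.mk _ (z ⊗ₜ[k] m))
        (e.apply_symm_apply v))
    (by
      apply Representation.Coinvariants.hom_ext
      ext v m
      exact congrArg (fun z => Representation.Coinvariants.mk _ (z ⊗ₜ[k] m))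
        (e.symm_apply_apply v))

/-- Naturality holds because `e` and `f` act on different tensor factors. -/
theorem RPart.congr_map {R : UnitaryRMatrix k V} {S : UnitaryRMatrix k W} {n : ℕ}
    (e : (powRep R n).Equiv (powRep S n)) {M N : FDRep k (Equiv.Perm (Fin n))} (f : M ⟶ N) :
    (RPart.congr e N).toLinearMap ∘ₗ RPart.map R n f =
      RPart.map S n f ∘ₗ (RPart.congr e M).toLinearMap := by
  apply Representation.Coinvariants.hom_ext
  ext v m
  rfl

/-- Equivalences of the representations on all tensor powers give an isomorphism of functors. -/
noncomputable def functorOfIso [FiniteDimensional k V] [FiniteDimensional k W]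
    {R : UnitaryRMatrix k V} {S : UnitaryRMatrix k W} (e : ∀ n, (powRep R n).Equiv (powRep S n)) : functorOf R ≅ functorOf S :=
  NatIso.ofComponents
    (fun M => LinearEquiv.toFGModuleCatIso
      (DFinsupp.mapRange.linearEquiv fun n => RPart.congr (e n) (M.obj n)))
    fun {M N} f => by
      apply FGModuleCat.hom_ext
      apply LinearMap.ext
      intro (x : ⨁ n, RPart R n (M.obj n))
      exact DFinsupp.ext fun n => LinearMap.congr_fun (RPart.congr_map (e n) (f.hom n)) (x n)

end Isomorphism

end FreeTensor

/-- Over a field of characteristic zero, the functors defined by two unitary `R`-matrices are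
isomorphic if and only if their Hilbert series coincide. -/
theorem mainTheorem5 {k : Type u} [Field k] [CharZero k]
    {V W : Type u} [AddCommGroup V] [Module k V] [FiniteDimensional k V]
    [AddCommGroup W] [Module k W] [FiniteDimensional k W]
    (R : FreeTensor.UnitaryRMatrix k V) (S : FreeTensor.UnitaryRMatrix k W) :
    Nonempty (FreeTensor.functorOf R ≅ FreeTensor.functorOf S) ↔
      FreeTensor.hilbertSeries k (FreeTensor.functorOf R) =
        FreeTensor.hilbertSeries k (FreeTensor.functorOf S) := by
  constructor
  · rintro ⟨e⟩
    ext n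
    simp only [FreeTensor.hilbertSeries, PowerSeries.coeff_mk]
    exact congrArg Nat.cast
      (FGModuleCat.isoToLinearEquiv (e.app (FreeTensor.extPower k n))).finrank_eq
  · intro h
    have hdim : ∀ n, Module.finrank k ((FreeTensor.functorOf R).obj (FreeTensor.extPower k n)) =
        Module.finrank k ((FreeTensor.functorOf S).obj (FreeTensor.extPower k n)) := by
      intro n
      have := congrArg (PowerSeries.coeff n) h
      simp only [FreeTensor.hilbertSeries, PowerSeries.coeff_mk] at this
      exact_mod_cast this
    have hchar := FreeTensor.character_powRep_eq R S fun n => by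
      rw [← FreeTensor.card_mul_finrank_functorOf_extPower,
        ← FreeTensor.card_mul_finrank_functorOf_extPower, hdim n]
    -- The equivalences are chosen independently in each degree; no compatibility with concatenation
    -- is needed, as the isomorphism need not be monoidal.
    exact ⟨FreeTensor.functorOfIso fun n =>
      (Representation.nonempty_equiv_of_character_eq _ _ (hchar n)).some⟩
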